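/- A base station with $L$ antennas serves a finite set $\Psi$ of user groups at once, with $Q$ users in each group. User $(\psi,k)$, $\psi\in\Psi$, $k\in\{1,\dots,Q\}$, has $M_{\psi,k}$ receive antennas and is sent $M_{\psi,k}$ symbols $s_{\psi,k,q}$, $1\le q\le M_{\psi,k}$, with (channel-independent) powers $P_{\psi,k,q}\ge 0$; the symbols are independent with mean $0$ and unit power. Let $\mathbf H_{\psi,k}\in\mathbb C^{L\times M_{\psi,k}}$ be the channel matrix of user $(\psi,k)$, $\mathbf H_\psi=[\mathbf H_{\psi,1},\dots,\mathbf H_{\psi,Q}]$ and $M_\psi=\sum_{k=1}^{Q} M_{\psi,k}$. The fading is independent Rayleigh fading with pathloss: all entries of all channel matrices are independent, and those of $\mathbf H_{\psi,k}$ are circularly symmetric complex Gaussian with mean $0$ and variance $\beta_{\psi,k}>0$. Under zero-forcing (ZF) precoding the base station transmits $\mathbf x=\sum_{\psi\in\Psi}\mathbf V_\psi\mathbf P_\psi\mathbf s_\psi$, where $\mathbf s_\psi$ collects the symbols of group $\psi$ (ordered as the columns of $\mathbf H_\psi$), $\mathbf P_\psi$ is the diagonal matrix of the corresponding $\sqrt{P_{\psi,k,q}}$,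 and $\mathbf V_\psi$ is $\mathbf H_\psi^*(\mathbf H_\psi^T\mathbf H_\psi^*)^{-1}$ with its $j$-th column multiplied by $\big([(\mathbf H_\psi^T\mathbf H_\psi^*)^{-1}]_{j,j}\big)^{-1/2}$ ($^*$ is entrywise conjugation). User $(\psi,k)$ receives $\mathbf H_{\psi,k}^T\mathbf x+\mathbf z_{\psi,k}$ with $\mathbf z_{\psi,k}\sim\mathcal{CN}(\mathbf 0,N_0\mathbf I)$, $N_0>0$, independent of the symbols, removes the contribution of the other groups (which it knows from its cache and the composite channel state), and decodes $s_{\psi,k,q}$ from the $q$-th entry of the result; let $\mathrm{SINR}_{\psi,k,q}$ be the corresponding signal-to-interference-plus-noise ratio, where the interference consists of all other symbols. Let $T>0$ be the coherence block length and $\Theta$ the number of pilot symbols per receive antenna, and suppose that $\xi=1-\frac{\Theta}{T}\sum_{\psi\in\Psi}\sum_{k=1}^{Q}M_{\psi,k}\ge 0$. The effective rate of user $(\psi,k)$, averaged over the channel fading, is $$\bar R^{\rm ZF}_{\psi,k}=\mathbb E\Big\{\xi\sum_{q=1}^{M_{\psi,k}}\ln\big(1+\mathrm{SINR}_{\psi,k,q}\big)\Big\}.$$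 Then, for every $\psi\in\Psi$ with $M_\psi\le L$ and every $k\in\{1,\dots,Q\}$, this expectation exists, is finite, and satisfies $$\xi\sum_{q=1}^{M_{\psi,k}}\ln\Big(1+\frac{P_{\psi,k,q}(L-M_\psi)\beta_{\psi,k}}{N_0}\Big)\;\le\;\bar R^{\rm ZF}_{\psi,k}\;\le\;\xi\sum_{q=1}^{M_{\psi,k}}\ln\Big(1+\frac{P_{\psi,k,q}(L-M_\psi+1)\beta_{\psi,k}}{N_0}\Big).$$ -/

import Mathlib

open MeasureTheory ProbabilityTheory
open scoped Matrix NNReal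

namespace VCC

noncomputable section

/-- The circularly symmetric complex Gaussian law `CN(0, v)` on `ℂ`: the real and the imaginary
part are independent real Gaussians with mean `0` and variance `v / 2`. -/
def complexGaussian (v : ℝ≥0) : Measure ℂ :=
  ((gaussianReal 0 (v / 2)).prod (gaussianReal 0 (v / 2))).map
    (fun x : ℝ × ℝ => (⟨x.1, x.2⟩ : ℂ))

/-- The symbols (streams) sent to one group, in which user `k` gets `m k` symbols: the pair
`(k, q)` stands for the `q`-th symbol of the `k`-th user. -/
abbrev Stream {Q : ℕ} (m : Fin Q → ℕ) : Type := (k : Fin Q) × Fin (m k)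

/-- All symbols sent in one transmission: a group `ψ`, a user `k` of it, and a symbol index. -/
abbrev Symbol {Ψ : Type*} {Q : ℕ} (M : Ψ → Fin Q → ℕ) : Type _ := (ψ : Ψ) × Stream (M ψ)

/-- A channel realization: the channel matrix `H ψ k` of each user, with one row for each of the
`L` transmit antennas and one column for each of the `M ψ k` receive antennas. -/
abbrev Channel {Ψ : Type*} {Q : ℕ} (L : ℕ) (M : Ψ → Fin Q → ℕ) : Type _ :=
  (ψ : Ψ) → (k : Fin Q) → Matrix (Fin L) (Fin (M ψ k)) ℂ

/-- Independent Rayleigh fading with pathloss `β ψ k`: all channel coefficients are mutually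
independent, and those of user `(ψ, k)` have the law `CN(0, β ψ k)`. -/
structure IsRayleighFading {Ω : Type*} [MeasurableSpace Ω] {Ψ : Type*} {Q L : ℕ}
    {M : Ψ → Fin Q → ℕ} (H : Ω → Channel L M) (β : Ψ → Fin Q → ℝ) (μ : Measure Ω) : Prop where
  hasLaw : ∀ (ψ : Ψ) (k : Fin Q) (l : Fin L) (q : Fin (M ψ k)),
    HasLaw (fun ω => H ω ψ k l q) (complexGaussian (β ψ k).toNNReal) μ
  indep : iIndepFun
    (fun (i : (ψ : Ψ) × (k : Fin Q) × (Fin L × Fin (M ψ k))) (ω : Ω) =>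
      H ω i.1 i.2.1 i.2.2.1 i.2.2.2) μ

/-- The channel matrix `H_ψ = [H_{ψ,1}, …, H_{ψ,Q}]` of one group. -/
def groupChannel {Q L : ℕ} {m : Fin Q → ℕ} (H : (k : Fin Q) → Matrix (Fin L) (Fin (m k)) ℂ) :
    Matrix (Fin L) (Stream m) ℂ :=
  Matrix.of fun l j => H j.1 l j.2

/-- The entrywise complex conjugate of a matrix. -/
def conjMatrix {m n : Type*} (A : Matrix m n ℂ) : Matrix m n ℂ := A.map (starRingEnd ℂ)

/-- `(H_ψᵀ H_ψ^*)⁻¹`. -/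
def invGram {Q L : ℕ} {m : Fin Q → ℕ} (H : (k : Fin Q) → Matrix (Fin L) (Fin (m k)) ℂ) :
    Matrix (Stream m) (Stream m) ℂ :=
  ((groupChannel H)ᵀ * conjMatrix (groupChannel H))⁻¹

/-- The zero-forcing precoder `V_ψ = (H_ψ^* (H_ψᵀ H_ψ^*)⁻¹) ∘ D_ψ` of one group, where all the
entries of the `j`-th column of `D_ψ` are `([(H_ψᵀ H_ψ^*)⁻¹]_{j,j}) ^ (-1/2)`. -/
def zfPrecoder {Q L : ℕ} {m : Fin Q → ℕ} (H : (k : Fin Q) → Matrix (Fin L) (Fin (m k)) ℂ) :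
    Matrix (Fin L) (Stream m) ℂ :=
  Matrix.hadamard (conjMatrix (groupChannel H) * invGram H)
    (Matrix.of fun _ j => (((invGram H j j).re ^ (-(1 / 2) : ℝ) : ℝ) : ℂ))

section System

variable {Ψ : Type*} [Fintype Ψ] [DecidableEq Ψ] {Q L : ℕ} {M : Ψ → Fin Q → ℕ}

/-- The precoded signal `V_ψ P_ψ s_ψ` of group `ψ`, where `P i` is the power of the symbol `i`. -/
def groupSignal (V : (ψ : Ψ) → Matrix (Fin L) (Stream (M ψ)) ℂ) (P : Symbol M → ℝ)
    (s : Symbol M → ℂ) (ψ : Ψ) : Fin L → ℂ :=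
  V ψ *ᵥ fun j => (Real.sqrt (P ⟨ψ, j⟩) : ℂ) * s ⟨ψ, j⟩

/-- The transmitted signal `x = ∑ ψ, V_ψ P_ψ s_ψ`. -/
def transmitSignal (V : (ψ : Ψ) → Matrix (Fin L) (Stream (M ψ)) ℂ) (P : Symbol M → ℝ)
    (s : Symbol M → ℂ) : Fin L → ℂ :=
  ∑ ψ, groupSignal V P s ψ

/-- The signal `y_{ψ,k} = H_{ψ,k}ᵀ x + z_{ψ,k}` received by user `(ψ, k)`. -/
def receivedSignal (H : Channel L M) (V : (ψ : Ψ) → Matrix (Fin L) (Stream (M ψ)) ℂ)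
    (P : Symbol M → ℝ) (s : Symbol M → ℂ) (ψ : Ψ) (k : Fin Q) (z : Fin (M ψ k) → ℂ) :
    Fin (M ψ k) → ℂ :=
  (H ψ k)ᵀ *ᵥ transmitSignal V P s + z

/-- The inter-group interference at user `(ψ, k)`: the part of the received signal that stems
from the other groups. The user knows it from its cache and from the composite channel state. -/
def interGroupInterference (H : Channel L M) (V : (ψ : Ψ) → Matrix (Fin L) (Stream (M ψ)) ℂ)
    (P : Symbol M → ℝ) (s : Symbol M → ℂ) (ψ : Ψ) (k : Fin Q) : Fin (M ψ k) → ℂ :=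
  (H ψ k)ᵀ *ᵥ ∑ φ ∈ Finset.univ.erase ψ, groupSignal V P s φ

/-- The signal from which user `(ψ, k)` decodes: the known inter-group interference is removed
from the received signal, and the decoding matrix `R` of the user is applied. -/
def decodingSignal (H : Channel L M) (V : (ψ : Ψ) → Matrix (Fin L) (Stream (M ψ)) ℂ)
    (P : Symbol M → ℝ) (s : Symbol M → ℂ) (ψ : Ψ) (k : Fin Q)
    (R : Matrix (Fin (M ψ k)) (Fin (M ψ k)) ℂ) (z : Fin (M ψ k) → ℂ) : Fin (M ψ k) → ℂ :=
  Rᴴ *ᵥ (receivedSignal H V P s ψ k z - interGroupInterference H V P s ψ k)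

/-- The coefficient of the symbol `i` in the `q`-th entry of the decoding signal of user `(ψ, k)`;
the decoding signal is linear in the symbols and the noise jointly. -/
def symbolGain (H : Channel L M) (V : (ψ : Ψ) → Matrix (Fin L) (Stream (M ψ)) ℂ)
    (P : Symbol M → ℝ) (ψ : Ψ) (k : Fin Q) (R : Matrix (Fin (M ψ k)) (Fin (M ψ k)) ℂ)
    (q : Fin (M ψ k)) (i : Symbol M) : ℂ :=
  decodingSignal H V P (Pi.single i 1) ψ k R 0 q

/-- The coefficient of the noise at receive antenna `r` in the `q`-th entry of the decoding signal
of user `(ψ, k)`. -/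
def noiseGain (H : Channel L M) (V : (ψ : Ψ) → Matrix (Fin L) (Stream (M ψ)) ℂ)
    (P : Symbol M → ℝ) (ψ : Ψ) (k : Fin Q) (R : Matrix (Fin (M ψ k)) (Fin (M ψ k)) ℂ)
    (q r : Fin (M ψ k)) : ℂ :=
  decodingSignal H V P 0 ψ k R (Pi.single r 1) q

/-- The signal-to-interference-plus-noise ratio for decoding the `q`-th symbol of user `(ψ, k)`,
for independent symbols with mean `0` and power `1` and for noise `CN(0, N₀ I)`: the power of the
contribution of that symbol, divided by the power of everything else. -/
def sinr (H : Channel L M) (V : (ψ : Ψ) → Matrix (Fin L) (Stream (M ψ)) ℂ)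
    (P : Symbol M → ℝ) (N₀ : ℝ) (ψ : Ψ) (k : Fin Q)
    (R : Matrix (Fin (M ψ k)) (Fin (M ψ k)) ℂ) (q : Fin (M ψ k)) : ℝ :=
  ‖symbolGain H V P ψ k R q ⟨ψ, k, q⟩‖ ^ 2 /
    (∑ i ∈ Finset.univ.erase (⟨ψ, k, q⟩ : Symbol M), ‖symbolGain H V P ψ k R q i‖ ^ 2
      + N₀ * ∑ r, ‖noiseGain H V P ψ k R q r‖ ^ 2)

/-- `ξ = 1 - Θ (∑ ψ, ∑ k, M_{ψ,k}) / T`: the fraction of a coherence block of `T` symbols that is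
left when `Θ` symbols per receive antenna are spent on pilots. -/
def csiFactor (M : Ψ → Fin Q → ℕ) (Θ T : ℝ) : ℝ :=
  1 - Θ * (∑ ψ, ∑ k, (M ψ k : ℝ)) / T

/-- The effective rate (in nats) of user `(ψ, k)` under zero-forcing, for a given channel
realization: every group uses the zero-forcing precoder, and the decoding matrix is `I`. -/
def zfRate (H : Channel L M) (P : Symbol M → ℝ) (N₀ Θ T : ℝ) (ψ : Ψ) (k : Fin Q) : ℝ :=
  csiFactor M Θ T *
    ∑ q, Real.log (1 + sinr H (fun φ => zfPrecoder (H φ)) P N₀ ψ k 1 q)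

/-- The effective rate of user `(ψ, k)` under zero-forcing, averaged over the channel fading. -/
def zfAverageRate {Ω : Type*} [MeasurableSpace Ω] (μ : Measure Ω) (H : Ω → Channel L M)
    (P : Symbol M → ℝ) (N₀ Θ T : ℝ) (ψ : Ψ) (k : Fin Q) : ℝ :=
  ∫ ω, zfRate (H ω) P N₀ Θ T ψ k ∂μ

/-- The lower bound `ξ ∑ q, ln (1 + P_{ψ,k,q} (L - M_ψ) β_{ψ,k} / N₀)`. -/
def zfLowerBound (L : ℕ) (β : Ψ → Fin Q → ℝ) (P : Symbol M → ℝ) (N₀ Θ T : ℝ)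
    (ψ : Ψ) (k : Fin Q) : ℝ :=
  csiFactor M Θ T *
    ∑ q : Fin (M ψ k),
      Real.log (1 + P ⟨ψ, k, q⟩ * ((L : ℝ) - (∑ k', (M ψ k' : ℝ))) * β ψ k / N₀)

/-- The upper bound `ξ ∑ q, ln (1 + P_{ψ,k,q} (L - M_ψ + 1) β_{ψ,k} / N₀)`. -/
def zfUpperBound (L : ℕ) (β : Ψ → Fin Q → ℝ) (P : Symbol M → ℝ) (N₀ Θ T : ℝ)
    (ψ : Ψ) (k : Fin Q) : ℝ :=
  csiFactor M Θ T *
    ∑ q : Fin (M ψ k),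
      Real.log (1 + P ⟨ψ, k, q⟩ * ((L : ℝ) - (∑ k', (M ψ k' : ℝ)) + 1) * β ψ k / N₀)

end System

end

end VCC

/-!
Zero-forcing removes the interference inside a group, so that the SINR of a stream is
`P / N₀` divided by the corresponding diagonal entry of the inverse Gram matrix `G⁻¹` of the
columns of the group channel. The number `1 / (G⁻¹) j j` is the squared norm of the projection of
column `j` onto the orthogonal complement of the other `M_ψ - 1` columns. As the columns are
independent and Gaussian vectors are rotation invariant, it has the law of `‖z‖ ^ 2`, where `z`
consists of `n = L - M_ψ + 1` independent `CN(0, β)` coordinates. The moments `E ‖z‖² = n β` and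
`E ‖z‖⁻² = 1 / ((n - 1) β)` then give the two bounds by Jensen's inequality, since
`log (1 + c x)` is concave in `x` and convex in `x⁻¹`.
-/

namespace VCC

open scoped ENNReal RealInnerProductSpace InnerProductSpace Topology
open Filter Module

noncomputable section

section ComplexGaussian

variable (v : ℝ≥0)

lemma measurable_complex_mk : Measurable fun x : ℝ × ℝ => (⟨x.1, x.2⟩ : ℂ) :=
  Complex.measurableEquivRealProd.symm.measurable

instance isProbabilityMeasure_complexGaussian : IsProbabilityMeasure (complexGaussian v) :=
  Measure.isProbabilityMeasure_map measurable_complex_mk.aemeasurable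

lemma charFun_complexGaussian (t : ℂ) :
    charFun (complexGaussian v) t = Complex.exp (-(v * ‖t‖ ^ 2 / 4 : ℝ)) := by
  have h_inner (x : ℝ × ℝ) : Complex.exp (⟪(⟨x.1, x.2⟩ : ℂ), t⟫_ℝ * Complex.I) =
      Complex.exp (t.re * x.1 * Complex.I) * Complex.exp (t.im * x.2 * Complex.I) := by
    rw [← Complex.exp_add, Complex.inner]
    congr 1
    simp only [Complex.mul_re, Complex.conj_re, Complex.conj_im]
    push_cast
    ring
  rw [charFun_apply, complexGaussian, integral_map measurable_complex_mk.aemeasurable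
    (by fun_prop)]
  simp_rw [h_inner]
  rw [integral_prod_mul (fun x : ℝ => Complex.exp (t.re * x * Complex.I))
    (fun x : ℝ => Complex.exp (t.im * x * Complex.I)), ← charFun_apply_real, ← charFun_apply_real,
    charFun_gaussianReal, charFun_gaussianReal, ← Complex.exp_add, Complex.sq_norm,
    Complex.normSq_apply]
  congr 1
  push_cast
  ring

lemma nullSingletonClass_complexGaussian {v : ℝ≥0} (hv : v ≠ 0) :
    NullSingletonClass (complexGaussian v) := by
  have := nullSingletonClass_gaussianReal (μ := 0) (half_pos (pos_iff_ne_zero.2 hv)).ne'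
  exact ⟨fun z => by
    rw [complexGaussian, Measure.map_apply measurable_complex_mk (measurableSet_singleton z)]
    exact (Set.subsingleton_singleton.preimage
      Complex.measurableEquivRealProd.symm.injective).measure_zero _⟩

lemma lintegral_sq_gaussianReal :
    ∫⁻ x, ENNReal.ofReal (x ^ 2) ∂(gaussianReal 0 v) = v := by
  have h_int : Integrable (fun x : ℝ => x ^ 2) (gaussianReal 0 v) :=
    (memLp_id_gaussianReal 2).integrable_sq
  have h_var := variance_of_integral_eq_zero (μ := gaussianReal 0 v) aemeasurable_id (by simp)
  rw [variance_id_gaussianReal] at h_var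
  rw [← ofReal_integral_eq_lintegral_ofReal h_int (ae_of_all _ fun x => sq_nonneg x),
    show ∫ x, x ^ 2 ∂(gaussianReal 0 v) = v from h_var.symm, ENNReal.ofReal_coe_nnreal]

lemma lintegral_norm_sq_complexGaussian :
    ∫⁻ z, ENNReal.ofReal (‖z‖ ^ 2) ∂(complexGaussian v) = v := by
  have h_fst := (measurePreserving_fst (μ := gaussianReal 0 (v / 2))
    (ν := gaussianReal 0 (v / 2))).lintegral_comp (f := fun x => ENNReal.ofReal (x ^ 2))
    (by fun_prop)
  have h_snd := (measurePreserving_snd (μ := gaussianReal 0 (v / 2))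
    (ν := gaussianReal 0 (v / 2))).lintegral_comp (f := fun x => ENNReal.ofReal (x ^ 2))
    (by fun_prop)
  rw [complexGaussian, lintegral_map (by fun_prop) measurable_complex_mk]
  simp_rw [Complex.sq_norm, Complex.normSq_mk, ← sq,
    ENNReal.ofReal_add (sq_nonneg _) (sq_nonneg _)]
  rw [lintegral_add_left (by fun_prop), h_fst, h_snd, lintegral_sq_gaussianReal]
  exact_mod_cast add_halves v

lemma integral_exp_neg_mul_sq_gaussianReal {t : ℝ} (ht : 0 ≤ t) :
    ∫ x, Real.exp (-(t * x ^ 2)) ∂(gaussianReal 0 v) = (√(1 + 2 * v * t))⁻¹ := by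
  rcases eq_or_ne v 0 with rfl | hv
  · simp
  have : (0 : ℝ) < v := by positivity
  have h_density (x : ℝ) : gaussianPDFReal 0 v x • Real.exp (-(t * x ^ 2)) =
      (√(2 * Real.pi * v))⁻¹ * Real.exp (-(t + (2 * v : ℝ)⁻¹) * x ^ 2) := by
    rw [gaussianPDFReal, smul_eq_mul, mul_assoc, ← Real.exp_add]
    congr 2
    field_simp
    ring
  rw [integral_gaussianReal_eq_integral_smul hv]
  simp_rw [h_density]
  rw [integral_const_mul, integral_gaussian, ← Real.sqrt_inv, ← Real.sqrt_inv,
    ← Real.sqrt_mul (by positivity)]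
  congr 1
  field_simp
  ring

lemma lintegral_exp_neg_mul_norm_sq_complexGaussian {t : ℝ} (ht : 0 ≤ t) :
    ∫⁻ z, ENNReal.ofReal (Real.exp (-(t * ‖z‖ ^ 2))) ∂(complexGaussian v) =
      ENNReal.ofReal (1 + v * t)⁻¹ := by
  have h_int : Integrable (fun z => Real.exp (-(t * ‖z‖ ^ 2))) (complexGaussian v) := by
    refine Integrable.of_bound (by fun_prop) 1 (ae_of_all _ fun z => ?_)
    rw [Real.norm_of_nonneg (Real.exp_pos _).le, Real.exp_le_one_iff, neg_nonpos]
    positivity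
  rw [← ofReal_integral_eq_lintegral_ofReal h_int (ae_of_all _ fun z => (Real.exp_pos _).le),
    complexGaussian, integral_map measurable_complex_mk.aemeasurable (by fun_prop)]
  simp_rw [Complex.sq_norm, Complex.normSq_mk, mul_add, neg_add, Real.exp_add, ← sq]
  rw [integral_prod_mul (fun x : ℝ => Real.exp (-(t * x ^ 2)))
    (fun x : ℝ => Real.exp (-(t * x ^ 2))), integral_exp_neg_mul_sq_gaussianReal _ ht,
    ← mul_inv, Real.mul_self_sqrt (by positivity)]
  congr 2
  push_cast
  ring

end ComplexGaussian

section GaussianVector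

variable {ι κ : Type*} [Fintype ι] [Fintype κ]

/-- The law `CN(0, v I)` of a vector of independent `CN(0, v)` variables indexed by `ι`, on the
Euclidean space, so that `‖·‖` is the Hermitian norm. -/
def gaussianVector (ι : Type*) [Fintype ι] (v : ℝ≥0) : Measure (EuclideanSpace ℂ ι) :=
  (Measure.pi fun _ => complexGaussian v).map (WithLp.toLp 2)

instance isProbabilityMeasure_gaussianVector (v : ℝ≥0) :
    IsProbabilityMeasure (gaussianVector ι v) :=
  Measure.isProbabilityMeasure_map (by fun_prop)

lemma charFun_gaussianVector (v : ℝ≥0) (t : EuclideanSpace ℂ ι) :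
    charFun (gaussianVector ι v) t = Complex.exp (-(v * ‖t‖ ^ 2 / 4 : ℝ)) := by
  rw [gaussianVector, charFun_pi]
  simp_rw [charFun_complexGaussian]
  rw [← Complex.exp_sum, EuclideanSpace.norm_sq_eq]
  congr 1
  push_cast
  rw [Finset.sum_neg_distrib, Finset.mul_sum, Finset.sum_div]

lemma real_inner_eq_re_inner_euclideanSpace (x y : EuclideanSpace ℂ ι) :
    ⟪x, y⟫_ℝ = (⟪x, y⟫_ℂ).re := by
  simp [PiLp.inner_apply, Complex.inner]

lemma map_repr_orthogonalProjection_gaussianVector (v : ℝ≥0)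
    {K : Submodule ℂ (EuclideanSpace ℂ ι)} (b : OrthonormalBasis κ ℂ K) :
    (gaussianVector ι v).map (fun x => b.repr (K.orthogonalProjectionOnto x)) =
      gaussianVector κ v := by
  have h_meas : Measurable fun x => b.repr (K.orthogonalProjectionOnto x) := by fun_prop
  have := Measure.isProbabilityMeasure_map (μ := gaussianVector ι v) h_meas.aemeasurable
  have h_adjoint (x t) : ⟪b.repr (K.orthogonalProjectionOnto x), t⟫_ℝ =
      ⟪x, ((b.repr.symm t : K) : EuclideanSpace ℂ ι)⟫_ℝ := by
    rw [real_inner_eq_re_inner_euclideanSpace, real_inner_eq_re_inner_euclideanSpace,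
      ← b.repr.symm.inner_map_map, b.repr.symm_apply_apply,
      Submodule.inner_orthogonalProjectionOnto_eq_of_mem_right]
  refine Measure.ext_of_charFun (funext fun t => ?_)
  rw [charFun_apply, integral_map h_meas.aemeasurable (by fun_prop)]
  simp_rw [h_adjoint]
  rw [← charFun_apply, charFun_gaussianVector, charFun_gaussianVector, ← Submodule.coe_norm,
    b.repr.symm.norm_map]

lemma nullSingletonClass_gaussianVector [Nonempty ι] {v : ℝ≥0} (hv : v ≠ 0) :
    NullSingletonClass (gaussianVector ι v) := by
  have := nullSingletonClass_complexGaussian hv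
  exact ⟨fun z => by
    rw [gaussianVector, Measure.map_apply (by fun_prop) (measurableSet_singleton z)]
    exact (Set.subsingleton_singleton.preimage (WithLp.toLp_injective 2)).measure_zero _⟩

lemma ae_notMem_gaussianVector {K : Submodule ℂ (EuclideanSpace ℂ ι)} (hK : K ≠ ⊤) {v : ℝ≥0}
    (hv : v ≠ 0) : ∀ᵐ x ∂(gaussianVector ι v), x ∉ K := by
  have : Nontrivial Kᗮ := Submodule.nontrivial_iff_ne_bot.2 (mt K.orthogonal_eq_bot_iff.1 hK)
  have : Nonempty (Fin (finrank ℂ Kᗮ)) := Fin.pos_iff_nonempty.1 finrank_pos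
  have := nullSingletonClass_gaussianVector (ι := Fin (finrank ℂ Kᗮ)) hv
  have h_null := measure_singleton (μ := gaussianVector (Fin (finrank ℂ Kᗮ)) v) 0
  rw [← map_repr_orthogonalProjection_gaussianVector v (stdOrthonormalBasis ℂ Kᗮ)] at h_null
  filter_upwards [ae_of_ae_map (by fun_prop) (measure_eq_zero_iff_ae_notMem.1 h_null)]
    with x hx hxK
  exact hx (by simp [Submodule.orthogonalProjectionOnto_orthogonal_apply_eq_zero hxK])

lemma lintegral_norm_sq_gaussianVector (v : ℝ≥0) :
    ∫⁻ z, ENNReal.ofReal (‖z‖ ^ 2) ∂(gaussianVector ι v) = Fintype.card ι * v := by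
  have h_coord (i : ι) : ∫⁻ a, ENNReal.ofReal (‖a i‖ ^ 2) ∂(Measure.pi fun _ => complexGaussian v)
      = v := by
    rw [← lintegral_norm_sq_complexGaussian v,
      ← (measurePreserving_eval (fun _ => complexGaussian v) i).lintegral_comp (by fun_prop)]
  rw [gaussianVector, lintegral_map (by fun_prop) (by fun_prop)]
  simp_rw [EuclideanSpace.norm_sq_eq, ENNReal.ofReal_sum_of_nonneg (fun _ _ => sq_nonneg _)]
  rw [lintegral_finsetSum _ (by fun_prop)]
  simp only [h_coord, Finset.sum_const, Finset.card_univ, nsmul_eq_mul]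

lemma lintegral_exp_neg_mul_norm_sq_gaussianVector (v : ℝ≥0) {t : ℝ} (ht : 0 ≤ t) :
    ∫⁻ z, ENNReal.ofReal (Real.exp (-(t * ‖z‖ ^ 2))) ∂(gaussianVector ι v) =
      ENNReal.ofReal ((1 + v * t)⁻¹ ^ Fintype.card ι) := by
  have h_coord (i : ι) : ∫⁻ a, ENNReal.ofReal (Real.exp (-(t * ‖a i‖ ^ 2)))
      ∂(Measure.pi fun _ => complexGaussian v) = ENNReal.ofReal (1 + v * t)⁻¹ := by
    rw [← lintegral_exp_neg_mul_norm_sq_complexGaussian v ht,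
      ← (measurePreserving_eval (fun _ => complexGaussian v) i).lintegral_comp (by fun_prop)]
  rw [gaussianVector, lintegral_map (by fun_prop) (by fun_prop)]
  simp_rw [EuclideanSpace.norm_sq_eq, Finset.mul_sum, ← Finset.sum_neg_distrib, Real.exp_sum,
    ENNReal.ofReal_prod_of_nonneg (fun _ _ => (Real.exp_pos _).le)]
  rw [lintegral_prod_eq_prod_lintegral_of_indepFun Finset.univ _ (iIndepFun_pi
    (X := fun (_ : ι) z => ENNReal.ofReal (Real.exp (-(t * ‖z‖ ^ 2)))) fun _ => by fun_prop)
    (by fun_prop)]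
  simp only [h_coord, Finset.prod_const, Finset.card_univ]
  rw [ENNReal.ofReal_pow (by positivity)]

end GaussianVector

section Moments

lemma setLIntegral_Ioi_inv_one_add_mul_pow {n : ℕ} (hn : 1 < n) {a : ℝ} (ha : 0 < a) :
    ∫⁻ t in Set.Ioi 0, ENNReal.ofReal ((1 + a * t)⁻¹ ^ n) =
      ENNReal.ofReal ((n - 1 : ℝ) * a)⁻¹ := by
  obtain ⟨n, rfl⟩ := Nat.exists_eq_add_of_lt hn
  set F : ℝ → ℝ := fun t => -(((n + 1) * a)⁻¹ * (1 + a * t)⁻¹ ^ (n + 1)) with hF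
  have h_deriv : ∀ t ∈ Set.Ici (0 : ℝ), HasDerivAt F ((1 + a * t)⁻¹ ^ (n + 2)) t := by
    intro t ht
    have ht : 0 ≤ t := ht
    have h_ne : 1 + a * t ≠ 0 := by positivity
    refine (((((hasDerivAt_id t).const_mul a).const_add 1).fun_inv h_ne).fun_pow (n + 1)
      |>.const_mul _).fun_neg.congr_deriv ?_
    simp only [id, Nat.add_sub_cancel, inv_pow]
    push_cast
    field_simp
    ring
  have h_lim : Tendsto F atTop (𝓝 0) := by
    have h_inv : Tendsto (fun t : ℝ => (1 + a * t)⁻¹) atTop (𝓝 0) :=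
      tendsto_inv_atTop_zero.comp
        (tendsto_atTop_add_const_left _ _ (tendsto_id.const_mul_atTop ha))
    have h := ((h_inv.pow (n + 1)).const_mul ((n + 1) * a)⁻¹).neg
    rwa [zero_pow n.succ_ne_zero, mul_zero, neg_zero] at h
  have h_nonneg : ∀ t ∈ Set.Ioi (0 : ℝ), 0 ≤ (1 + a * t)⁻¹ ^ (n + 2) := by
    intro t ht
    have ht : 0 < t := ht
    positivity
  have h_exp : 1 + n + 1 = n + 2 := by ring
  rw [h_exp, ← ofReal_integral_eq_lintegral_ofReal
    (integrableOn_Ioi_deriv_of_nonneg' h_deriv h_nonneg h_lim)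
    (ae_restrict_of_forall_mem measurableSet_Ioi h_nonneg),
    integral_Ioi_of_hasDerivAt_of_nonneg' h_deriv h_nonneg h_lim]
  congr 1
  simp only [hF]
  push_cast
  ring

lemma setLIntegral_Ioi_exp_neg_mul {a : ℝ} (ha : 0 < a) :
    ∫⁻ t in Set.Ioi (0 : ℝ), ENNReal.ofReal (Real.exp (-(t * a))) = ENNReal.ofReal a⁻¹ := by
  simp_rw [mul_comm _ a, ← neg_mul]
  rw [← ofReal_integral_eq_lintegral_ofReal (integrableOn_exp_mul_Ioi (neg_neg_of_pos ha) 0)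
    (ae_of_all _ fun t => (Real.exp_pos _).le), integral_exp_mul_Ioi (neg_neg_of_pos ha)]
  simp

variable {ι : Type*} [Fintype ι] {v : ℝ≥0}

lemma integrable_norm_sq_gaussianVector : Integrable (fun z => ‖z‖ ^ 2) (gaussianVector ι v) := by
  rw [← lintegral_ofReal_ne_top_iff_integrable (by fun_prop) (ae_of_all _ fun z => sq_nonneg _),
    lintegral_norm_sq_gaussianVector]
  finiteness

lemma integral_norm_sq_gaussianVector :
    ∫ z, ‖z‖ ^ 2 ∂(gaussianVector ι v) = Fintype.card ι * v := by
  rw [integral_eq_lintegral_of_nonneg_ae (ae_of_all _ fun z => sq_nonneg _) (by fun_prop),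
    lintegral_norm_sq_gaussianVector]
  simp

lemma ae_norm_sq_pos_gaussianVector [Nonempty ι] (hv : v ≠ 0) :
    ∀ᵐ z ∂(gaussianVector ι v), 0 < ‖z‖ ^ 2 := by
  have := nullSingletonClass_gaussianVector (ι := ι) hv
  filter_upwards [measure_eq_zero_iff_ae_notMem.1 (measure_singleton 0)] with z hz
  exact pow_pos (norm_pos_iff.2 hz) 2

lemma lintegral_inv_norm_sq_gaussianVector (hι : 1 < Fintype.card ι) (hv : v ≠ 0) :
    ∫⁻ z, ENNReal.ofReal (‖z‖ ^ 2)⁻¹ ∂(gaussianVector ι v) =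
      ENNReal.ofReal ((Fintype.card ι - 1 : ℝ) * v)⁻¹ := by
  have : Nonempty ι := Fintype.card_pos_iff.1 (by lia)
  calc ∫⁻ z, ENNReal.ofReal (‖z‖ ^ 2)⁻¹ ∂(gaussianVector ι v)
      = ∫⁻ z, (∫⁻ t in Set.Ioi (0 : ℝ), ENNReal.ofReal (Real.exp (-(t * ‖z‖ ^ 2))))
          ∂(gaussianVector ι v) := by
        refine lintegral_congr_ae ?_
        filter_upwards [ae_norm_sq_pos_gaussianVector hv] with z hz
        exact (setLIntegral_Ioi_exp_neg_mul hz).symm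
    _ = ∫⁻ t in Set.Ioi (0 : ℝ), ∫⁻ z, ENNReal.ofReal (Real.exp (-(t * ‖z‖ ^ 2)))
          ∂(gaussianVector ι v) :=
        lintegral_lintegral_swap (Measurable.aemeasurable (by fun_prop))
    _ = ∫⁻ t in Set.Ioi (0 : ℝ), ENNReal.ofReal ((1 + v * t)⁻¹ ^ Fintype.card ι) :=
        setLIntegral_congr_fun measurableSet_Ioi fun t ht =>
          lintegral_exp_neg_mul_norm_sq_gaussianVector v (le_of_lt ht)
    _ = ENNReal.ofReal ((Fintype.card ι - 1 : ℝ) * v)⁻¹ :=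
        setLIntegral_Ioi_inv_one_add_mul_pow hι (NNReal.coe_pos.2 (pos_iff_ne_zero.2 hv))

lemma integrable_inv_norm_sq_gaussianVector (hι : 1 < Fintype.card ι) (hv : v ≠ 0) :
    Integrable (fun z => (‖z‖ ^ 2)⁻¹) (gaussianVector ι v) := by
  rw [← lintegral_ofReal_ne_top_iff_integrable
    (Measurable.aestronglyMeasurable (by fun_prop)) (ae_of_all _ fun z => by positivity),
    lintegral_inv_norm_sq_gaussianVector hι hv]
  exact ENNReal.ofReal_ne_top

lemma integral_inv_norm_sq_gaussianVector (hι : 1 < Fintype.card ι) (hv : v ≠ 0) :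
    ∫ z, (‖z‖ ^ 2)⁻¹ ∂(gaussianVector ι v) = ((Fintype.card ι - 1 : ℝ) * v)⁻¹ := by
  have h_pos : (0 : ℝ) ≤ Fintype.card ι - 1 := sub_nonneg.2 (by exact_mod_cast hι.le)
  rw [integral_eq_lintegral_of_nonneg_ae (ae_of_all _ fun z => by positivity)
    (Measurable.aestronglyMeasurable (by fun_prop)),
    lintegral_inv_norm_sq_gaussianVector hι hv, ENNReal.toReal_ofReal (by positivity)]

end Moments

section Jensen

variable {Ω : Type*} [MeasurableSpace Ω] {μ : Measure Ω} {X : Ω → ℝ} {c : ℝ}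

lemma integrable_log_one_add_mul (hc : 0 ≤ c) (hX : 0 ≤ᵐ[μ] X) (hX_int : Integrable X μ) :
    Integrable (fun ω => Real.log (1 + c * X ω)) μ := by
  refine (hX_int.const_mul c).mono' (Real.measurable_log.comp_aemeasurable
    ((hX_int.aemeasurable.const_mul c).const_add 1)).aestronglyMeasurable ?_
  filter_upwards [hX] with ω hω
  have h_nonneg : 0 ≤ c * X ω := mul_nonneg hc hω
  rw [Real.norm_of_nonneg (Real.log_nonneg (by linarith))]
  linarith [Real.log_le_sub_one_of_pos (show 0 < 1 + c * X ω by linarith)]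

lemma concaveOn_log_one_add_mul (hc : 0 ≤ c) :
    ConcaveOn ℝ (Set.Ici 0) fun x => Real.log (1 + c * x) :=
  (strictConcaveOn_log_Ioi.concaveOn.comp_affineMap (AffineMap.lineMap 1 (1 + c))).subset
    (fun x (hx : 0 ≤ x) => by
      rw [Set.mem_preimage, AffineMap.lineMap_apply_ring', Set.mem_Ioi, add_sub_cancel_left]
      positivity)
    (convex_Ici 0) |>.congr fun x _ => by
      simp [AffineMap.lineMap_apply_ring', add_comm, mul_comm]

/-- The inequality is linear in `x⁻¹`: it is the tangent at `x₀` of `log (1 + c x)`, which is a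
convex function of `x⁻¹`. -/
lemma log_one_add_mul_add_le {x x₀ : ℝ} (hc : 0 ≤ c) (hx : 0 < x) (hx₀ : 0 ≤ x₀) :
    Real.log (1 + c * x₀) + c * x₀ / (1 + c * x₀) * (1 - x₀ * x⁻¹) ≤ Real.log (1 + c * x) := by
  have h_log : Real.log (1 + c * x₀) - Real.log (1 + c * x) ≤
      (1 + c * x₀) / (1 + c * x) - 1 := by
    rw [← Real.log_div (by positivity) (by positivity)]
    exact Real.log_le_sub_one_of_pos (by positivity)
  have h_gap : 1 - (1 + c * x₀) / (1 + c * x) - c * x₀ / (1 + c * x₀) * (1 - x₀ * x⁻¹) =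
      c * (x₀ - x) ^ 2 / (x * (1 + c * x₀) * (1 + c * x)) := by
    field_simp
    ring
  have h_gap_nonneg : 0 ≤ c * (x₀ - x) ^ 2 / (x * (1 + c * x₀) * (1 + c * x)) := by positivity
  linarith

variable [IsProbabilityMeasure μ]

lemma integral_log_one_add_mul_le (hc : 0 ≤ c) (hX : 0 ≤ᵐ[μ] X) (hX_int : Integrable X μ) :
    ∫ ω, Real.log (1 + c * X ω) ∂μ ≤ Real.log (1 + c * ∫ ω, X ω ∂μ) := by
  refine (concaveOn_log_one_add_mul hc).le_map_integral ?_ isClosed_Ici hX hX_int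
    (integrable_log_one_add_mul hc hX hX_int)
  exact ContinuousOn.log (by fun_prop) fun x (hx : 0 ≤ x) => by positivity

lemma le_integral_log_one_add_mul (hc : 0 ≤ c) (hX : ∀ᵐ ω ∂μ, 0 < X ω)
    (hX_inv : Integrable (fun ω => (X ω)⁻¹) μ)
    (hX_log : Integrable (fun ω => Real.log (1 + c * X ω)) μ) :
    Real.log (1 + c * (∫ ω, (X ω)⁻¹ ∂μ)⁻¹) ≤ ∫ ω, Real.log (1 + c * X ω) ∂μ := by
  set y := ∫ ω, (X ω)⁻¹ ∂μ with hy
  have h_y : 0 ≤ y := integral_nonneg_of_ae (by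
    filter_upwards [hX] with ω hω using (inv_pos.2 hω).le)
  have h_slope : 0 ≤ c * y⁻¹ / (1 + c * y⁻¹) := by positivity
  have h_tangent : Integrable (fun ω => c * y⁻¹ / (1 + c * y⁻¹) * (1 - y⁻¹ * (X ω)⁻¹)) μ :=
    ((integrable_const _).sub (hX_inv.const_mul _)).const_mul _
  calc Real.log (1 + c * y⁻¹)
      ≤ Real.log (1 + c * y⁻¹) + c * y⁻¹ / (1 + c * y⁻¹) * (1 - y⁻¹ * y) :=
        le_add_of_nonneg_right (mul_nonneg h_slope (sub_nonneg.2 inv_mul_le_one))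
    _ = ∫ ω, (Real.log (1 + c * y⁻¹) + c * y⁻¹ / (1 + c * y⁻¹) * (1 - y⁻¹ * (X ω)⁻¹)) ∂μ := by
        rw [integral_add (integrable_const _) h_tangent, integral_const_mul,
          integral_sub (integrable_const _) (hX_inv.const_mul _), integral_const_mul, ← hy]
        simp
    _ ≤ ∫ ω, Real.log (1 + c * X ω) ∂μ :=
        integral_mono_ae ((integrable_const _).add h_tangent) hX_log (by
          filter_upwards [hX] with ω hω using
            log_one_add_mul_add_le hc hω (inv_nonneg.2 h_y))

end Jensen

section ErgodicRate

variable {ι : Type*} [Fintype ι] {v : ℝ≥0} {c : ℝ}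

lemma integrable_log_one_add_mul_norm_sq_gaussianVector (hc : 0 ≤ c) :
    Integrable (fun z => Real.log (1 + c * ‖z‖ ^ 2)) (gaussianVector ι v) :=
  integrable_log_one_add_mul hc (ae_of_all _ fun z => sq_nonneg ‖z‖)
    integrable_norm_sq_gaussianVector

lemma integral_log_one_add_mul_norm_sq_gaussianVector_le (hc : 0 ≤ c) :
    ∫ z, Real.log (1 + c * ‖z‖ ^ 2) ∂(gaussianVector ι v) ≤
      Real.log (1 + c * (Fintype.card ι * v)) := by
  rw [← integral_norm_sq_gaussianVector]
  exact integral_log_one_add_mul_le hc (ae_of_all _ fun z => sq_nonneg ‖z‖)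
    integrable_norm_sq_gaussianVector

lemma le_integral_log_one_add_mul_norm_sq_gaussianVector [Nonempty ι] (hc : 0 ≤ c) (hv : v ≠ 0) :
    Real.log (1 + c * ((Fintype.card ι - 1 : ℝ) * v)) ≤
      ∫ z, Real.log (1 + c * ‖z‖ ^ 2) ∂(gaussianVector ι v) := by
  rcases (show 1 ≤ Fintype.card ι from Fintype.card_pos).eq_or_lt with hι | hι
  · rw [← hι, Nat.cast_one, sub_self, zero_mul, mul_zero, add_zero, Real.log_one]
    exact integral_nonneg fun z => Real.log_nonneg (by
      have : 0 ≤ c * ‖z‖ ^ 2 := by positivity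
      linarith)
  · rw [← inv_inv ((Fintype.card ι - 1 : ℝ) * v), ← integral_inv_norm_sq_gaussianVector hι hv]
    exact le_integral_log_one_add_mul hc (ae_norm_sq_pos_gaussianVector hv)
      (integrable_inv_norm_sq_gaussianVector hι hv)
      (integrable_log_one_add_mul_norm_sq_gaussianVector hc)

end ErgodicRate

section Gram

variable {ι 𝕜 E : Type*} [Fintype ι] [RCLike 𝕜] [NormedAddCommGroup E] [InnerProductSpace 𝕜 E]

lemma gram_mulVec_apply (w : ι → E) (a : ι → 𝕜) (i : ι) :
    (Matrix.gram 𝕜 w *ᵥ a) i = inner 𝕜 (w i) (∑ k, a k • w k) := by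
  simp only [Matrix.mulVec, dotProduct, Matrix.gram_apply, inner_sum, inner_smul_right, mul_comm]

lemma exists_sum_smul_eq_starProjection (w : ι → E) (j : ι)
    [(Submodule.span 𝕜 (w '' {j}ᶜ)).HasOrthogonalProjection] :
    ∃ a : ι → 𝕜, a j = 1 ∧
      ∑ k, a k • w k = (Submodule.span 𝕜 (w '' {j}ᶜ))ᗮ.starProjection (w j) := by
  classical
  obtain ⟨c, hc, hc_sum⟩ := (Finsupp.mem_span_image_iff_linearCombination 𝕜).1
    ((Submodule.span 𝕜 (w '' {j}ᶜ)).starProjection_apply_mem (w j))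
  have hcj : c j = 0 := by
    by_contra h
    exact hc (Finsupp.mem_support_iff.2 h) rfl
  refine ⟨(Pi.single j 1 : ι → 𝕜) - ⇑c, by simp [hcj], ?_⟩
  rw [Submodule.starProjection_orthogonal_val, ← hc_sum, Finsupp.linearCombination_apply,
    Finsupp.sum_fintype _ _ (by simp)]
  simp [sub_smul, Finset.sum_sub_distrib, Pi.single_apply]

variable [DecidableEq ι]

/-- Writing the projection as `∑ i, a i • w i` with `a j = 1`, the Gram matrix maps `a` to a
multiple of the `j`-th unit vector. -/
lemma inv_gram_apply_self {w : ι → E} (hw : LinearIndependent 𝕜 w) (j : ι)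
    [(Submodule.span 𝕜 (w '' {j}ᶜ)).HasOrthogonalProjection] :
    (Matrix.gram 𝕜 w)⁻¹ j j =
      (((‖(Submodule.span 𝕜 (w '' {j}ᶜ))ᗮ.orthogonalProjectionOnto (w j)‖ ^ 2)⁻¹ : ℝ) : 𝕜) := by
  set K := (Submodule.span 𝕜 (w '' {j}ᶜ))ᗮ
  set r : 𝕜 := ((‖K.orthogonalProjectionOnto (w j)‖ ^ 2 : ℝ) : 𝕜) with hr
  obtain ⟨a, haj, ha⟩ := exists_sum_smul_eq_starProjection (𝕜 := 𝕜) w j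
  have h_gram : Matrix.gram 𝕜 w *ᵥ a = Pi.single j r := by
    ext i
    rw [gram_mulVec_apply, ha]
    rcases eq_or_ne i j with rfl | hij
    · rw [Pi.single_eq_same, hr, RCLike.ofReal_pow, ← inner_self_eq_norm_sq_to_K,
        Submodule.coe_inner, Submodule.coe_orthogonalProjectionOnto_apply]
      exact (K.inner_orthogonalProjectionOnto_eq_of_mem_right _ _).symm
    · rw [Pi.single_eq_of_ne hij]
      exact Submodule.inner_right_of_mem_orthogonal
        (Submodule.subset_span (Set.mem_image_of_mem w hij)) (K.starProjection_apply_mem (w j))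
  have h_det : IsUnit (Matrix.gram 𝕜 w).det :=
    (Matrix.det_gram_ne_zero_iff_linearIndependent.2 hw).isUnit
  have h_mul : (Matrix.gram 𝕜 w)⁻¹ j j * r = 1 := by
    rw [← haj, ← Matrix.one_mulVec a, ← Matrix.nonsing_inv_mul _ h_det, ← Matrix.mulVec_mulVec,
      h_gram, Matrix.mulVec_single]
    simp
  rw [RCLike.ofReal_inv]
  exact eq_inv_of_mul_eq_one_left h_mul

end Gram

section Resampling

variable {ι : Type*} [Fintype ι] [DecidableEq ι] {α : ι → Type*} [∀ i, MeasurableSpace (α i)]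
  (μ : ∀ i, Measure (α i)) [∀ i, SigmaFinite (μ i)] (j : ι) [IsProbabilityMeasure (μ j)]

lemma measurePreserving_update :
    MeasurePreserving (fun p : (∀ i, α i) × α j => Function.update p.1 j p.2)
      ((Measure.pi μ).prod (μ j)) (Measure.pi μ) := by
  refine ⟨measurable_update', (Measure.pi_eq fun s hs => ?_).symm⟩
  have h_preimage : (fun p : (∀ i, α i) × α j => Function.update p.1 j p.2) ⁻¹' Set.univ.pi s =
      Set.univ.pi (Function.update s j Set.univ) ×ˢ s j := by
    ext p
    simp only [Set.mem_preimage, Set.mem_prod, Set.mem_univ_pi]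
    refine ⟨fun h => ⟨fun i => ?_, by simpa using h j⟩, fun h i => ?_⟩
    · rcases eq_or_ne i j with rfl | hij
      · simp
      · simpa [hij] using h i
    · rcases eq_or_ne i j with rfl | hij
      · simpa using h.2
      · simpa [hij] using h.1 i
  rw [Measure.map_apply measurable_update' (.univ_pi hs), h_preimage, Measure.prod_prod,
    Measure.pi_pi, ← Finset.prod_erase_mul _ _ (Finset.mem_univ j),
    ← Finset.prod_erase_mul Finset.univ (fun i => μ i (s i)) (Finset.mem_univ j),
    Function.update_self, measure_univ, mul_one]
  congr 1
  exact Finset.prod_congr rfl fun i hi => by rw [Function.update_of_ne (Finset.ne_of_mem_erase hi)]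

lemma lintegral_pi_eq_lintegral_lintegral_update {f : (∀ i, α i) → ℝ≥0∞} (hf : Measurable f) :
    ∫⁻ w, f w ∂Measure.pi μ = ∫⁻ w, ∫⁻ x, f (Function.update w j x) ∂μ j ∂Measure.pi μ := by
  rw [← (measurePreserving_update μ j).lintegral_comp hf]
  exact lintegral_prod _ (hf.comp measurable_update').aemeasurable

lemma ae_pi_of_ae_ae_update {p : (∀ i, α i) → Prop} (hp : MeasurableSet {w | p w})
    (h : ∀ᵐ w ∂Measure.pi μ, ∀ᵐ x ∂μ j, p (Function.update w j x)) :
    ∀ᵐ w ∂Measure.pi μ, p w := by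
  rw [← (measurePreserving_update μ j).map_eq,
    ae_map_iff measurable_update'.aemeasurable hp]
  exact (Measure.ae_prod_iff_ae_ae (measurable_update' hp)).2 h

end Resampling

section Columns

lemma linearIndepOn_insert_update {ι K V : Type*} [DecidableEq ι] [DivisionRing K] [AddCommGroup V]
    [Module K V] {w : ι → V} {s : Set ι} {j : ι} (hj : j ∉ s) {x : V} :
    LinearIndepOn K (Function.update w j x) (insert j s) ↔
      LinearIndepOn K w s ∧ x ∉ Submodule.span K (w '' s) := by
  have h_eqOn : Set.EqOn (Function.update w j x) w s := fun i hi =>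
    Function.update_of_ne (ne_of_mem_of_not_mem hi hj) x w
  rw [linearIndepOn_insert hj, linearIndepOn_congr h_eqOn, h_eqOn.image_eq, Function.update_self]

lemma measurableSet_linearIndepOn {ι κ : Type*} [Finite ι] [Finite κ] (s : Set ι) :
    MeasurableSet {w : ι → EuclideanSpace ℂ κ | LinearIndepOn ℂ w s} := by
  have := Fintype.ofFinite κ
  exact (isOpen_setOfPred_linearIndependent (ι := s)).measurableSet.preimage (by fun_prop)

variable {ι κ : Type*} [Fintype ι] [Fintype κ] {b : ι → ℝ≥0}

lemma ae_linearIndepOn_gaussianVector (hb : ∀ j, b j ≠ 0) (s : Finset ι)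
    (hs : s.card ≤ Fintype.card κ) :
    ∀ᵐ w ∂Measure.pi fun j => gaussianVector κ (b j), LinearIndepOn ℂ w s := by
  classical
  induction s using Finset.induction_on with
  | empty => simp
  | insert j s hj ih =>
    rw [Finset.card_insert_of_notMem hj] at hs
    refine ae_pi_of_ae_ae_update _ j (measurableSet_linearIndepOn _) ?_
    · filter_upwards [ih (by lia)] with w hw
      have h_rank : finrank ℂ (Submodule.span ℂ (w '' s)) < finrank ℂ (EuclideanSpace ℂ κ) := by
        rw [finrank_euclideanSpace, ← Finset.coe_image]
        exact (finrank_span_finset_le_card (R := ℂ) (s.image w)).trans_lt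
          (Finset.card_image_le.trans_lt (by lia))
      filter_upwards [ae_notMem_gaussianVector
        (Submodule.lt_top_of_finrank_lt_finrank h_rank).ne (hb j)] with x hx
      rw [Finset.coe_insert]
      exact (linearIndepOn_insert_update (by simpa using hj)).2 ⟨hw, hx⟩

lemma ae_linearIndependent_gaussianVector (hb : ∀ j, b j ≠ 0)
    (hι : Fintype.card ι ≤ Fintype.card κ) :
    ∀ᵐ w ∂Measure.pi fun j => gaussianVector κ (b j), LinearIndependent ℂ w := by
  simpa [linearIndepOn_univ_iff] using ae_linearIndepOn_gaussianVector hb Finset.univ hι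

lemma finrank_orthogonal_span_image_compl {w : ι → EuclideanSpace ℂ κ} {j : ι}
    (hw : LinearIndepOn ℂ w {j}ᶜ) :
    finrank ℂ (Submodule.span ℂ (w '' {j}ᶜ))ᗮ + Fintype.card ι = Fintype.card κ + 1 := by
  classical
  have h_rank : finrank ℂ (Submodule.span ℂ (w '' {j}ᶜ)) = Fintype.card ι - 1 := by
    rw [Set.image_eq_range, finrank_span_eq_card hw, Fintype.card_compl_set,
      Set.card_singleton]
  have h_add := (Submodule.span ℂ (w '' {j}ᶜ)).finrank_add_finrank_orthogonal
  rw [h_rank, finrank_euclideanSpace] at h_add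
  have := Fintype.card_pos_iff.2 ⟨j⟩
  omega

variable [DecidableEq ι]

lemma measurable_inv_gram_apply_self (j : ι) :
    Measurable fun w : ι → EuclideanSpace ℂ κ => (Matrix.gram ℂ w)⁻¹ j j := by
  have h_gram : Continuous fun w : ι → EuclideanSpace ℂ κ => Matrix.gram ℂ w :=
    continuous_matrix fun i k => by
      simp only [Matrix.gram_apply]
      fun_prop
  simp_rw [Matrix.inv_def, Ring.inverse_eq_inv', Matrix.smul_apply, smul_eq_mul]
  exact h_gram.matrix_det.measurable.inv.mul
    (h_gram.matrix_adjugate.matrix_elem j j).measurable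

lemma map_inv_inv_gram_update {v : ℝ≥0} (hv : v ≠ 0)
    (hι : Fintype.card ι ≤ Fintype.card κ) {w : ι → EuclideanSpace ℂ κ} {j : ι}
    (hw : LinearIndepOn ℂ w {j}ᶜ) :
    (gaussianVector κ v).map (fun x => ((Matrix.gram ℂ (Function.update w j x))⁻¹ j j).re⁻¹) =
      (gaussianVector (Fin (Fintype.card κ - Fintype.card ι + 1)) v).map (‖·‖ ^ 2) := by
  set K := Submodule.span ℂ (w '' {j}ᶜ)
  have h_rank : finrank ℂ Kᗮ = Fintype.card κ - Fintype.card ι + 1 := by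
    have : finrank ℂ Kᗮ + _ = _ := finrank_orthogonal_span_image_compl hw
    omega
  have h_ne_top : K ≠ ⊤ := fun h => by
    rw [h, Submodule.top_orthogonal_eq_bot, finrank_bot] at h_rank
    omega
  let e := (stdOrthonormalBasis ℂ Kᗮ).reindex (finCongr h_rank)
  have h_ae : (fun x => ((Matrix.gram ℂ (Function.update w j x))⁻¹ j j).re⁻¹) =ᵐ[gaussianVector κ v]
      fun x => ‖e.repr (Kᗮ.orthogonalProjectionOnto x)‖ ^ 2 := by
    filter_upwards [ae_notMem_gaussianVector h_ne_top hv] with x hx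
    have h_indep : LinearIndependent ℂ (Function.update w j x) := by
      have := (linearIndepOn_insert_update (s := {j}ᶜ) (j := j) (by simp)).2 ⟨hw, hx⟩
      rwa [Set.insert_eq, Set.union_compl_self, linearIndepOn_univ_iff] at this
    have h_image : Function.update w j x '' {j}ᶜ = w '' {j}ᶜ :=
      Set.image_congr fun i hi => Function.update_of_ne hi x w
    rw [inv_gram_apply_self h_indep, Function.update_self, h_image, LinearIsometryEquiv.norm_map]
    exact inv_inv (‖Kᗮ.orthogonalProjectionOnto x‖ ^ 2)
  rw [Measure.map_congr h_ae, ← map_repr_orthogonalProjection_gaussianVector v e, Measure.map_map]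
  · rfl
  · fun_prop
  · fun_prop

lemma hasLaw_inv_inv_gram_gaussianVector (hb : ∀ j, b j ≠ 0)
    (hι : Fintype.card ι ≤ Fintype.card κ) (j : ι) :
    HasLaw (fun w => ((Matrix.gram ℂ w)⁻¹ j j).re⁻¹)
      ((gaussianVector (Fin (Fintype.card κ - Fintype.card ι + 1)) (b j)).map (‖·‖ ^ 2))
      (Measure.pi fun i => gaussianVector κ (b i)) := by
  have h_meas : Measurable fun w : ι → EuclideanSpace ℂ κ => ((Matrix.gram ℂ w)⁻¹ j j).re⁻¹ :=
    (Complex.measurable_re.comp (measurable_inv_gram_apply_self j)).inv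
  refine ⟨h_meas.aemeasurable, Measure.ext_of_lintegral _ fun f hf => ?_⟩
  rw [lintegral_map hf h_meas]
  refine (lintegral_pi_eq_lintegral_lintegral_update _ j (hf.comp h_meas)).trans ?_
  trans ∫⁻ _, ∫⁻ y, f y ∂((gaussianVector (Fin (Fintype.card κ - Fintype.card ι + 1)) (b j)).map
    (‖·‖ ^ 2)) ∂(Measure.pi fun i => gaussianVector κ (b i))
  · refine lintegral_congr_ae ?_
    filter_upwards [ae_linearIndependent_gaussianVector hb hι] with w hw
    rw [← map_inv_inv_gram_update (j := j) (hb j) hι (hw.linearIndepOn _)]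
    exact (lintegral_map hf (h_meas.comp (measurable_update w))).symm
  · simp

end Columns

section Precoding

variable {Q L : ℕ} {m : Fin Q → ℕ} {H : (k : Fin Q) → Matrix (Fin L) (Fin (m k)) ℂ}

/-- The column of the group channel matrix that belongs to the stream `j`, as a vector of `ℂ^L`
with the Euclidean norm. -/
def column (H : (k : Fin Q) → Matrix (Fin L) (Fin (m k)) ℂ) (j : Stream m) :
    EuclideanSpace ℂ (Fin L) :=
  WithLp.toLp 2 fun l => H j.1 l j.2

lemma transpose_mul_conjMatrix_groupChannel (H : (k : Fin Q) → Matrix (Fin L) (Fin (m k)) ℂ) :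
    (groupChannel H)ᵀ * conjMatrix (groupChannel H) = (Matrix.gram ℂ (column H))ᵀ := by
  ext i j
  simp [Matrix.mul_apply, PiLp.inner_apply, column, groupChannel, conjMatrix]

lemma invGram_apply_self (H : (k : Fin Q) → Matrix (Fin L) (Fin (m k)) ℂ) (j : Stream m) :
    invGram H j j = (Matrix.gram ℂ (column H))⁻¹ j j := by
  rw [invGram, transpose_mul_conjMatrix_groupChannel, ← Matrix.transpose_nonsing_inv,
    Matrix.transpose_apply]

lemma re_invGram_apply_self_pos (hH : LinearIndependent ℂ (column H)) (j : Stream m) :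
    0 < (invGram H j j).re := by
  open scoped ComplexOrder in
  have h_pos := (Matrix.posDef_gram_of_linearIndependent hH).inv.diag_pos (i := j)
  rw [invGram_apply_self]
  exact (Complex.lt_def.1 h_pos).1

lemma transpose_groupChannel_mul_zfPrecoder (hH : LinearIndependent ℂ (column H)) :
    (groupChannel H)ᵀ * zfPrecoder H =
      Matrix.diagonal fun j => (((invGram H j j).re ^ (-(1 / 2) : ℝ) : ℝ) : ℂ) := by
  have h_precoder : zfPrecoder H = conjMatrix (groupChannel H) * invGram H *
      Matrix.diagonal fun j => (((invGram H j j).re ^ (-(1 / 2) : ℝ) : ℝ) : ℂ) := by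
    ext l j
    simp only [zfPrecoder, Matrix.hadamard_apply, Matrix.of_apply, Matrix.mul_diagonal]
  have h_det : IsUnit ((groupChannel H)ᵀ * conjMatrix (groupChannel H)).det := by
    rw [transpose_mul_conjMatrix_groupChannel, Matrix.det_transpose, isUnit_iff_ne_zero]
    exact Matrix.det_gram_ne_zero_iff_linearIndependent.2 hH
  rw [h_precoder, ← Matrix.mul_assoc, ← Matrix.mul_assoc, invGram, Matrix.mul_nonsing_inv _ h_det,
    Matrix.one_mul]

end Precoding

section Decoding

variable {Ψ : Type*} [Fintype Ψ] [DecidableEq Ψ] {Q L : ℕ} {M : Ψ → Fin Q → ℕ}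
  {H : Channel L M} {ψ : Ψ}

lemma decodingSignal_one (H : Channel L M) (V : (ψ : Ψ) → Matrix (Fin L) (Stream (M ψ)) ℂ)
    (P : Symbol M → ℝ) (s : Symbol M → ℂ) (ψ : Ψ) (k : Fin Q) (z : Fin (M ψ k) → ℂ) :
    decodingSignal H V P s ψ k 1 z = (H ψ k)ᵀ *ᵥ groupSignal V P s ψ + z := by
  rw [decodingSignal, receivedSignal, interGroupInterference, transmitSignal,
    ← Finset.add_sum_erase _ _ (Finset.mem_univ ψ), Matrix.mulVec_add, Matrix.conjTranspose_one,
    Matrix.one_mulVec]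
  abel

lemma decodingSignal_zf (hH : LinearIndependent ℂ (column (H ψ))) (P : Symbol M → ℝ)
    (s : Symbol M → ℂ) (k : Fin Q) (z : Fin (M ψ k) → ℂ) (q : Fin (M ψ k)) :
    decodingSignal H (fun φ => zfPrecoder (H φ)) P s ψ k 1 z q =
      (((invGram (H ψ) ⟨k, q⟩ ⟨k, q⟩).re ^ (-(1 / 2) : ℝ) : ℝ) : ℂ) *
        ((√(P ⟨ψ, k, q⟩) : ℂ) * s ⟨ψ, k, q⟩) + z q := by
  have h_group : ((H ψ k)ᵀ *ᵥ groupSignal (fun φ => zfPrecoder (H φ)) P s ψ) q =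
      (((groupChannel (H ψ))ᵀ * zfPrecoder (H ψ)) *ᵥ
        fun j => (√(P ⟨ψ, j⟩) : ℂ) * s ⟨ψ, j⟩) ⟨k, q⟩ := by
    rw [← Matrix.mulVec_mulVec]
    rfl
  rw [decodingSignal_one, Pi.add_apply, h_group, transpose_groupChannel_mul_zfPrecoder hH,
    Matrix.mulVec_diagonal]

lemma sinr_zf (hH : LinearIndependent ℂ (column (H ψ))) {P : Symbol M → ℝ} {k : Fin Q}
    {q : Fin (M ψ k)} (hP : 0 ≤ P ⟨ψ, k, q⟩) (N₀ : ℝ) :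
    sinr H (fun φ => zfPrecoder (H φ)) P N₀ ψ k 1 q =
      P ⟨ψ, k, q⟩ / N₀ * (invGram (H ψ) ⟨k, q⟩ ⟨k, q⟩).re⁻¹ := by
  have h_pos := re_invGram_apply_self_pos hH ⟨k, q⟩
  have h_signal : ‖symbolGain H (fun φ => zfPrecoder (H φ)) P ψ k 1 q ⟨ψ, k, q⟩‖ ^ 2 =
      (invGram (H ψ) ⟨k, q⟩ ⟨k, q⟩).re⁻¹ * P ⟨ψ, k, q⟩ := by
    rw [symbolGain, decodingSignal_zf hH, Pi.single_eq_same, Pi.zero_apply, mul_one, add_zero,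
      ← Complex.ofReal_mul, Complex.norm_real, Real.norm_eq_abs, sq_abs, mul_pow,
      Real.sq_sqrt hP, ← Real.rpow_mul_natCast h_pos.le]
    norm_num [Real.rpow_neg_one]
  have h_interference : ∑ i ∈ Finset.univ.erase (⟨ψ, k, q⟩ : Symbol M),
      ‖symbolGain H (fun φ => zfPrecoder (H φ)) P ψ k 1 q i‖ ^ 2 = 0 := by
    refine Finset.sum_eq_zero fun i hi => ?_
    rw [symbolGain, decodingSignal_zf hH, Pi.single_eq_of_ne (Finset.ne_of_mem_erase hi).symm]
    simp
  have h_noise : ∑ r, ‖noiseGain H (fun φ => zfPrecoder (H φ)) P ψ k 1 q r‖ ^ 2 = 1 := by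
    simp [noiseGain, decodingSignal_zf hH, Pi.single_apply, ite_pow, apply_ite]
  rw [sinr, h_signal, h_interference, h_noise]
  ring

end Decoding

lemma csiFactor_nonneg {Ψ : Type*} [Fintype Ψ] {Q : ℕ} {M : Ψ → Fin Q → ℕ} {Θ T : ℝ}
    (hT : 0 < T) (hΘ : Θ * ∑ ψ, ∑ k, (M ψ k : ℝ) ≤ T) :
    0 ≤ csiFactor M Θ T :=
  sub_nonneg.2 ((div_le_one hT).2 hΘ)

section Fading

lemma measurePreserving_curry {ι κ X : Type*} [Fintype ι] [Fintype κ] [MeasurableSpace X]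
    (μ : ι → κ → Measure X) [∀ i j, IsProbabilityMeasure (μ i j)] :
    MeasurePreserving (MeasurableEquiv.curry ι κ X) (Measure.pi fun p : ι × κ => μ p.1 p.2)
      (Measure.pi fun i => Measure.pi (μ i)) := by
  refine ⟨(MeasurableEquiv.curry ι κ X).measurable, ?_⟩
  simp_rw [← Measure.infinitePi_eq_pi]
  exact Measure.infinitePi_map_curry μ

variable {Ω Ψ : Type*} [MeasurableSpace Ω] {μ : Measure Ω} {Q L : ℕ} {M : Ψ → Fin Q → ℕ}
  {H : Ω → Channel L M} {β : Ψ → Fin Q → ℝ}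

lemma IsRayleighFading.iIndepFun_group (hH : IsRayleighFading H β μ) (ψ : Ψ) :
    iIndepFun (fun (p : Stream (M ψ) × Fin L) (ω : Ω) => H ω ψ p.1.1 p.2 p.1.2) μ := by
  refine hH.indep.precomp (g := fun p : Stream (M ψ) × Fin L =>
    (⟨ψ, p.1.1, p.2, p.1.2⟩ : (ψ : Ψ) × (k : Fin Q) × (Fin L × Fin (M ψ k)))) ?_
  rintro ⟨⟨k, q⟩, l⟩ ⟨⟨k', q'⟩, l'⟩ h
  simp only [Sigma.mk.injEq, heq_eq_eq, true_and] at h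
  obtain ⟨rfl, h⟩ := h
  simp only [heq_eq_eq, Prod.mk.injEq] at h
  obtain ⟨rfl, rfl⟩ := h
  rfl

lemma IsRayleighFading.hasLaw_column (hH : IsRayleighFading H β μ) (ψ : Ψ) :
    HasLaw (fun ω => column (H ω ψ))
      (Measure.pi fun j : Stream (M ψ) => gaussianVector (Fin L) (β ψ j.1).toNNReal) μ := by
  have h_entries := (hH.iIndepFun_group ψ).hasLaw_pi
    fun p : Stream (M ψ) × Fin L => hH.hasLaw ψ p.1.1 p.2 p.1.2
  have h_curry := measurePreserving_curry
    fun (j : Stream (M ψ)) (_ : Fin L) => complexGaussian (β ψ j.1).toNNReal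
  have h_toLp : MeasurePreserving (fun (w : Stream (M ψ) → Fin L → ℂ) j => WithLp.toLp 2 (w j))
      (Measure.pi fun j => Measure.pi fun _ => complexGaussian (β ψ j.1).toNNReal)
      (Measure.pi fun j => gaussianVector (Fin L) (β ψ j.1).toNNReal) :=
    measurePreserving_pi _ _ fun j => ⟨by fun_prop, rfl⟩
  exact (h_toLp.comp h_curry).comp_hasLaw h_entries

variable {ψ : Ψ}

lemma IsRayleighFading.ae_linearIndependent_column (hH : IsRayleighFading H β μ)
    (hβ : ∀ k, 0 < β ψ k) (hL : ∑ k, M ψ k ≤ L) :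
    ∀ᵐ ω ∂μ, LinearIndependent ℂ (column (H ω ψ)) := by
  have h_law := hH.hasLaw_column ψ
  refine ae_of_ae_map h_law.aemeasurable (p := fun w => LinearIndependent ℂ w) ?_
  rw [h_law.map_eq]
  exact ae_linearIndependent_gaussianVector
    (fun j => (Real.toNNReal_pos.2 (hβ j.1)).ne') (by simpa using hL)

lemma IsRayleighFading.hasLaw_inv_re_invGram_apply_self (hH : IsRayleighFading H β μ)
    (hβ : ∀ k, 0 < β ψ k) (hL : ∑ k, M ψ k ≤ L) (j : Stream (M ψ)) :
    HasLaw (fun ω => (invGram (H ω ψ) j j).re⁻¹)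
      ((gaussianVector (Fin (L - ∑ k, M ψ k + 1)) (β ψ j.1).toNNReal).map (‖·‖ ^ 2)) μ := by
  have h_gram := hasLaw_inv_inv_gram_gaussianVector (κ := Fin L)
    (fun j : Stream (M ψ) => (Real.toNNReal_pos.2 (hβ j.1)).ne') (by simpa using hL) j
  have h_dim : Fintype.card (Fin L) - Fintype.card (Stream (M ψ)) = L - ∑ k, M ψ k := by simp
  rw [h_dim] at h_gram
  have h_eq : (fun ω => (invGram (H ω ψ) j j).re⁻¹) =
      (fun w => ((Matrix.gram ℂ w)⁻¹ j j).re⁻¹) ∘ fun ω => column (H ω ψ) :=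
    funext fun ω => by rw [invGram_apply_self, Function.comp_apply]
  rw [h_eq]
  exact h_gram.comp (hH.hasLaw_column ψ)

lemma IsRayleighFading.integrable_log_inv_re_invGram (hH : IsRayleighFading H β μ)
    (hβ : ∀ k, 0 < β ψ k) (hL : ∑ k, M ψ k ≤ L) (j : Stream (M ψ)) {c : ℝ} (hc : 0 ≤ c) :
    Integrable (fun ω => Real.log (1 + c * (invGram (H ω ψ) j j).re⁻¹)) μ := by
  have h_law := hH.hasLaw_inv_re_invGram_apply_self hβ hL j
  have h_log : Measurable fun x : ℝ => Real.log (1 + c * x) := by fun_prop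
  refine (integrable_map_measure h_log.aestronglyMeasurable h_law.aemeasurable).1 ?_
  rw [h_law.map_eq, integrable_map_measure h_log.aestronglyMeasurable (by fun_prop)]
  exact integrable_log_one_add_mul_norm_sq_gaussianVector hc

lemma IsRayleighFading.integral_log_inv_re_invGram (hH : IsRayleighFading H β μ)
    (hβ : ∀ k, 0 < β ψ k) (hL : ∑ k, M ψ k ≤ L) (j : Stream (M ψ)) (c : ℝ) :
    ∫ ω, Real.log (1 + c * (invGram (H ω ψ) j j).re⁻¹) ∂μ =
      ∫ z, Real.log (1 + c * ‖z‖ ^ 2)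
        ∂gaussianVector (Fin (L - ∑ k, M ψ k + 1)) (β ψ j.1).toNNReal := by
  have h_law := hH.hasLaw_inv_re_invGram_apply_self hβ hL j
  have h_log : Measurable fun x : ℝ => Real.log (1 + c * x) := by fun_prop
  rw [← integral_map h_law.aemeasurable h_log.aestronglyMeasurable, h_law.map_eq,
    integral_map (by fun_prop) h_log.aestronglyMeasurable]

variable [Fintype Ψ] [DecidableEq Ψ] {P : Symbol M → ℝ} {N₀ : ℝ} {k : Fin Q}

lemma IsRayleighFading.zfRate_ae_eq (hH : IsRayleighFading H β μ) (hβ : ∀ k, 0 < β ψ k)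
    (hL : ∑ k, M ψ k ≤ L) (hP : ∀ q, 0 ≤ P ⟨ψ, k, q⟩) (N₀ Θ T : ℝ) :
    (fun ω => zfRate (H ω) P N₀ Θ T ψ k) =ᵐ[μ] fun ω => csiFactor M Θ T *
      ∑ q, Real.log (1 + P ⟨ψ, k, q⟩ / N₀ * (invGram (H ω ψ) ⟨k, q⟩ ⟨k, q⟩).re⁻¹) := by
  filter_upwards [hH.ae_linearIndependent_column hβ hL] with ω hω
  simp_rw [zfRate, sinr_zf hω (hP _)]

lemma IsRayleighFading.integrable_zfRate (hH : IsRayleighFading H β μ) (hβ : ∀ k, 0 < β ψ k)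
    (hL : ∑ k, M ψ k ≤ L) (hP : ∀ q, 0 ≤ P ⟨ψ, k, q⟩) (hN₀ : 0 ≤ N₀) (Θ T : ℝ) :
    Integrable (fun ω => zfRate (H ω) P N₀ Θ T ψ k) μ := by
  rw [integrable_congr (hH.zfRate_ae_eq hβ hL hP N₀ Θ T)]
  exact (integrable_finsetSum _ fun q _ =>
    hH.integrable_log_inv_re_invGram hβ hL ⟨k, q⟩ (div_nonneg (hP q) hN₀)).const_mul _

lemma IsRayleighFading.zfAverageRate_eq (hH : IsRayleighFading H β μ) (hβ : ∀ k, 0 < β ψ k)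
    (hL : ∑ k, M ψ k ≤ L) (hP : ∀ q, 0 ≤ P ⟨ψ, k, q⟩) (hN₀ : 0 ≤ N₀) (Θ T : ℝ) :
    zfAverageRate μ H P N₀ Θ T ψ k = csiFactor M Θ T *
      ∑ q, ∫ z, Real.log (1 + P ⟨ψ, k, q⟩ / N₀ * ‖z‖ ^ 2)
        ∂gaussianVector (Fin (L - ∑ k, M ψ k + 1)) (β ψ k).toNNReal := by
  rw [zfAverageRate, integral_congr_ae (hH.zfRate_ae_eq hβ hL hP N₀ Θ T), integral_const_mul,
    integral_finsetSum _ fun q _ =>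
      hH.integrable_log_inv_re_invGram hβ hL ⟨k, q⟩ (div_nonneg (hP q) hN₀)]
  simp_rw [hH.integral_log_inv_re_invGram hβ hL]

end Fading

end

end VCC

theorem proposition1 {Ω : Type*} [MeasurableSpace Ω] (μ : Measure Ω) [IsProbabilityMeasure μ]
    {Ψ : Type*} [Fintype Ψ] [DecidableEq Ψ] {Q L : ℕ} {M : Ψ → Fin Q → ℕ}
    (H : Ω → VCC.Channel L M) (β : Ψ → Fin Q → ℝ) (P : VCC.Symbol M → ℝ) (N₀ Θ T : ℝ)
    (hβ : ∀ ψ k, 0 < β ψ k) (hP : ∀ i, 0 ≤ P i) (hN₀ : 0 < N₀)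
    (hT : 0 < T) (hΘ : Θ * (∑ ψ, ∑ k, (M ψ k : ℝ)) ≤ T)
    (hH : VCC.IsRayleighFading H β μ)
    (ψ : Ψ) (k : Fin Q) (hL : ∑ k', M ψ k' ≤ L) :
    Integrable (fun ω => VCC.zfRate (H ω) P N₀ Θ T ψ k) μ ∧
      VCC.zfLowerBound L β P N₀ Θ T ψ k ≤ VCC.zfAverageRate μ H P N₀ Θ T ψ k ∧
      VCC.zfAverageRate μ H P N₀ Θ T ψ k ≤ VCC.zfUpperBound L β P N₀ Θ T ψ k := by
  have h_csi : 0 ≤ VCC.csiFactor M Θ T := VCC.csiFactor_nonneg hT hΘ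
  have h_snr (q : Fin (M ψ k)) : 0 ≤ P ⟨ψ, k, q⟩ / N₀ := div_nonneg (hP _) hN₀.le
  have h_dim : (Fintype.card (Fin (L - ∑ k', M ψ k' + 1)) : ℝ) = L - ∑ k', (M ψ k' : ℝ) + 1 := by
    simp [Nat.cast_sub hL]
  have h_coe : ((β ψ k).toNNReal : ℝ) = β ψ k := Real.coe_toNNReal _ (hβ ψ k).le
  refine ⟨hH.integrable_zfRate (hβ ψ) hL (fun _ => hP _) hN₀.le Θ T, ?_, ?_⟩
  all_goals
    rw [hH.zfAverageRate_eq (hβ ψ) hL (fun _ => hP _) hN₀.le]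
    refine mul_le_mul_of_nonneg_left (Finset.sum_le_sum fun q _ => ?_) h_csi
  · refine le_of_eq_of_le (congrArg Real.log ?_)
      (VCC.le_integral_log_one_add_mul_norm_sq_gaussianVector (h_snr q)
        (Real.toNNReal_pos.2 (hβ ψ k)).ne')
    rw [h_dim, h_coe]
    ring
  · refine (VCC.integral_log_one_add_mul_norm_sq_gaussianVector_le (h_snr q)).trans_eq
      (congrArg Real.log ?_)
    rw [h_dim, h_coe]
    ring
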